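/- Let $n\ge 2$, $S^n=\{p\in\mathbb R^{n+1}:|p|=1\}$, $p_0=(0,\dots,0,1)\in S^n$, $T_pS^n=p^\perp$ and $TS^n=\{(p,v):|p|=1,\ p\cdot v=0\}\subset\mathbb R^{n+1}\times\mathbb R^{n+1}$. **The groupoid $\tilde S$.** In $G=SO_0(1,n+1)$ let $B=\{\mathrm{diag}(1,g):g\in SO(n+1)\}$, and let $C$ be the group of matrices $$(s,y):=\begin{pmatrix}\frac{s^2+1+|y|^2}{2s}&-\frac1s y^t&\frac{s^2-1+|y|^2}{2s}\\-y&I&-y\\ \frac{s^2-1-|y|^2}{2s}&\frac1s y^t&\frac{s^2+1-|y|^2}{2s}\end{pmatrix},\qquad s>0,\ y\in\mathbb R^n,$$ so that $G=BC=CB$ (Iwasawa decomposition). Let $G_B\rightrightarrows B$ be the groupoid on $G$ in which the product of $c_1b$ and $bc_2$ ($b\in B$, $c_1,c_2\in C$) is $c_1bc_2$. Its quotient by the right action of $SO(n)\subset B$ (the stabilizer of $p_0$ in $B$) is identified with $Z=TS^n\times\mathbb R_+$ by $\pi_Z:\ b\,(s,y)\mapsto (b p_0,\ b(y,0),\ s)$,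 and the graph of the multiplication of $Z$ is the image of that of $G_B$ under $\pi_Z\times\pi_Z\times\pi_Z$. Let $\tilde S=TS^n\times\{1\}\simeq TS^n$ be the subgroupoid $s=1$ of $Z$; its units are $(p,0)$, $p\in S^n$, and its left projection is $(p,v)\mapsto p$. Denote its right projection by $\tilde e_R:TS^n\to S^n$ (so $\gamma\cdot(\tilde e_R(\gamma),0)=\gamma$). **Its Lie algebroid.** $\mathcal L(\tilde S)=TS^n$, where $(p,v)$ is the vector at the unit $(p,0)$ represented by the curve $t\mapsto(p,tv)$ in the left fiber. The bracket of smooth sections $X,Y$ is the restriction to the units of the Lie bracket of the left-invariant vector fields on $\tilde S$ extending $X$ and $Y$; the anchor $\tilde\rho$ is the restriction to $\mathcal L(\tilde S)$ of the tangent map of $\tilde e_R$. Put $P_p(w)=w-(w\cdot p)p$, let $e_1,\dots,e_{n+1}$ be the canonical basis of $\mathbb R^{n+1}$, and let $\tilde Y_i(p)=P_p(e_i)$, $i=1,\dots,n+1$. **Proposition.** These objects are well defined: every $\gamma\in\tilde S$ has exactly one right unit, $\tilde e_R$ is smooth, the $\tilde Y_i$ are smooth sections, and every smooth section of $TS^n$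 has exactly one extension to a smooth left-invariant vector field on $\tilde S$. Moreover: 1. For every $p\in S^n$: $T_pS^n=\mathrm{span}\{\tilde Y_i(p):i=1,\dots,n+1\}$. 2. If $p\in S^n$ and $p^i\ne0$, then the family $(\tilde Y_j(p))_{j\neq i}$ is a basis of $T_pS^n$. 3. For $i,j=1,\dots,n+1$ and $p\in S^n$: $[\tilde Y_i,\tilde Y_j](p)=(p^j-\delta_{j,n+1})\tilde Y_i(p)-(p^i-\delta_{i,n+1})\tilde Y_j(p)$. 4. $\tilde\rho(p,v)=(p,(p^{n+1}-1)v)$ for $(p,v)\in TS^n$. 5. $[X,Y](p_0)=0$ for any two smooth sections $X,Y$ of $\mathcal L(\tilde S)$. -/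

import Mathlib

open scoped ContDiff

namespace EuclideanLines

noncomputable section

/-- The Euclidean space `ℝⁿ⁺¹`. Coordinates are numbered by `Fin (n + 1)`; the last
coordinate, number `n + 1`, is `Fin.last n`. -/
abbrev E (n : ℕ) : Type := EuclideanSpace ℝ (Fin (n + 1))

/-- The canonical basis vector `e_i` of `ℝⁿ⁺¹`. -/
def e {n : ℕ} (i : Fin (n + 1)) : E n := EuclideanSpace.single i 1

/-- The distinguished point `p₀ = (0, …, 0, 1)` of the sphere. -/
def p₀ (n : ℕ) : E n := e (Fin.last n)

/-- The unit sphere `Sⁿ ⊂ ℝⁿ⁺¹`. -/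
def S (n : ℕ) : Set (E n) := Metric.sphere 0 1

/-- The tangent space `T_p Sⁿ = p^⊥`, a subspace of `ℝⁿ⁺¹`. -/
def T {n : ℕ} (p : E n) : Submodule ℝ (E n) := (Submodule.span ℝ {p})ᗮ

/-- `TSⁿ = {(p, v) : |p| = 1, p · v = 0}`, a submanifold of `ℝⁿ⁺¹ × ℝⁿ⁺¹`. -/
def TS (n : ℕ) : Set (E n × E n) := {γ | γ.1 ∈ S n ∧ γ.2 ∈ T γ.1}

/-- The vector `(y, 0)` of `ℝⁿ⁺¹`, for `y ∈ ℝⁿ`. -/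
def pad {n : ℕ} (y : EuclideanSpace ℝ (Fin n)) : E n :=
  WithLp.toLp 2 (Fin.snoc (α := fun _ => ℝ) (fun i => y i) 0)

/-! ### The groups `B` and `C` of the Iwasawa decomposition of `SO₀(1, n+1)` -/

/-- Square matrices of size `n + 2`; the time coordinate is `Sum.inl ()`. -/
abbrev Mat (n : ℕ) : Type := Matrix (Unit ⊕ Fin (n + 1)) (Unit ⊕ Fin (n + 1)) ℝ

/-- The embedding `g ↦ diag(1, g)` of `(n+1) × (n+1)` matrices. -/
def matB {n : ℕ} (b : Matrix (Fin (n + 1)) (Fin (n + 1)) ℝ) : Mat n :=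
  Matrix.fromBlocks 1 0 0 b

/-- The matrix
```
  (s²+1+|y|²)/2s   -yᵗ/s   (s²-1+|y|²)/2s
  -y                 I      -y
  (s²-1-|y|²)/2s    yᵗ/s   (s²+1-|y|²)/2s
```
denoted by `(s, y)`. -/
def matC {n : ℕ} (s : ℝ) (y : EuclideanSpace ℝ (Fin n)) : Mat n :=
  Matrix.fromBlocks
    (Matrix.of fun _ _ => (s ^ 2 + 1 + ‖y‖ ^ 2) / (2 * s))
    (Matrix.of fun _ => Fin.snoc (α := fun _ => ℝ) (fun i => -(y i / s))
      ((s ^ 2 - 1 + ‖y‖ ^ 2) / (2 * s)))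
    (Matrix.of fun k _ => Fin.snoc (α := fun _ => ℝ) (fun i => -y i)
      ((s ^ 2 - 1 - ‖y‖ ^ 2) / (2 * s)) k)
    (Matrix.of (Fin.snoc (α := fun _ => Fin (n + 1) → ℝ)
      (fun i => Fin.snoc (α := fun _ => ℝ) (Pi.single i 1) (-y i))
      (Fin.snoc (α := fun _ => ℝ) (fun i => y i / s) ((s ^ 2 + 1 - ‖y‖ ^ 2) / (2 * s)))))

/-- The subgroup `B = SO(n+1)` of `SO₀(1, n+1)`. -/
def B (n : ℕ) : Set (Mat n) :=
  {g | ∃ b ∈ Matrix.specialOrthogonalGroup (Fin (n + 1)) ℝ, g = matB b}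

/-- The subgroup `C = {(s, y) : s > 0, y ∈ ℝⁿ}` of `SO₀(1, n+1)`. -/
def C (n : ℕ) : Set (Mat n) :=
  {g | ∃ s : ℝ, 0 < s ∧ ∃ y : EuclideanSpace ℝ (Fin n), g = matC s y}

/-! ### The groupoids -/

/-- Graph of the multiplication `(g₃; g₁, g₂)` of the groupoid `G_B : G ⇉ B`, `G = BC = CB`:
it consists of the triples `(c₁ b c₂; c₁ b, b c₂)` with `b ∈ B`, `c₁, c₂ ∈ C`. -/
def MulB {n : ℕ} (g₃ g₁ g₂ : Mat n) : Prop :=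
  ∃ b ∈ B n, ∃ c₁ ∈ C n, ∃ c₂ ∈ C n, g₁ = c₁ * b ∧ g₂ = b * c₂ ∧ g₃ = c₁ * b * c₂

/-- Graph of the projection `π_Z` from `G` to `Z = G_B / SO(n)`, where `Z` is identified with
`TSⁿ × ℝ₊`: the class of `g = b (s, y)` is `(b p₀, b (y, 0), s)`; in block notation
`b = (Λ, u, w, α)` this is `((u, α), (Λ y, wᵗ y), s)`. -/
def ProjZ {n : ℕ} (g : Mat n) (z : (E n × E n) × ℝ) : Prop :=
  ∃ b ∈ Matrix.specialOrthogonalGroup (Fin (n + 1)) ℝ, ∃ s : ℝ, 0 < s ∧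
    ∃ y : EuclideanSpace ℝ (Fin n), g = matB b * matC s y ∧
      z = ((Matrix.toEuclideanLin b (p₀ n), Matrix.toEuclideanLin b (pad y)), s)

/-- Graph of the multiplication of the quotient groupoid `Z`: the image of the graph of the
multiplication of `G_B` under `π_Z × π_Z × π_Z`. -/
def MulZ {n : ℕ} (z₃ z₁ z₂ : (E n × E n) × ℝ) : Prop :=
  ∃ g₃ g₁ g₂ : Mat n, MulB g₃ g₁ g₂ ∧ ProjZ g₃ z₃ ∧ ProjZ g₁ z₁ ∧ ProjZ g₂ z₂

/-- Graph of the multiplication of the subgroupoid `S̃ = TSⁿ × {1} ≃ TSⁿ` of `Z`: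
`Mul γ₃ γ₁ γ₂` says that `γ₁`, `γ₂` are composable and `γ₁ γ₂ = γ₃`. The units are the
elements `(q, 0)`, `q ∈ Sⁿ`. -/
def Mul {n : ℕ} (γ₃ γ₁ γ₂ : E n × E n) : Prop := MulZ (γ₃, 1) (γ₁, 1) (γ₂, 1)

/-- `(q, 0)` is the left (target) unit of `γ`. -/
def IsLeftUnit {n : ℕ} (γ : E n × E n) (q : E n) : Prop := q ∈ S n ∧ Mul γ (q, 0) γ

/-- `(q, 0)` is the right (source) unit of `γ`. -/
def IsRightUnit {n : ℕ} (γ : E n × E n) (q : E n) : Prop := q ∈ S n ∧ Mul γ γ (q, 0)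

/-- The left fiber of the groupoid `S̃` passing through `γ`. -/
def leftFiber {n : ℕ} (γ : E n × E n) : Set (E n × E n) :=
  {γ' | γ' ∈ TS n ∧ ∃ q, IsLeftUnit γ q ∧ IsLeftUnit γ' q}

/-- The right (source) projection `e_R : S̃ → Sⁿ`. -/
def eR {n : ℕ} (γ : E n × E n) : E n := Classical.epsilon (IsRightUnit γ)

/-! ### The Lie algebroid of `S̃`

A vector `(p, v) ∈ TSⁿ` is regarded as the vector at the unit `(p, 0) ∈ S̃`, tangent to the left
fiber, which is represented by the curve `t ↦ (p, t v)`, that is as the vector `(0, v)` of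
`ℝⁿ⁺¹ × ℝⁿ⁺¹`. Sections and vector fields are functions on the ambient space whose values
outside `Sⁿ`, respectively outside `TSⁿ`, play no role. -/

/-- `v ∈ T_p Sⁿ` as a vector tangent at the unit `(p, 0)` to the left fiber. -/
def vert {n : ℕ} (v : E n) : E n × E n := (0, v)

/-- Smooth sections of `L(S̃) = TSⁿ`. -/
structure IsSection {n : ℕ} (X : E n → E n) : Prop where
  smooth : ContDiffOn ℝ ∞ X (S n)
  tangent : ∀ p ∈ S n, X p ∈ T p

/-- The curve `c` lies in the left fiber through `γ` and represents the vector `ζ` at `γ`. -/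
def Represents {n : ℕ} (c : ℝ → E n × E n) (γ ζ : E n × E n) : Prop :=
  c 0 = γ ∧ (∀ t, c t ∈ leftFiber γ) ∧ HasDerivAt c ζ 0

/-- `ξ` is a smooth left-invariant vector field on `S̃`: it is smooth, tangent to the left fibers,
and the left translation by `γ₁` maps `ξ(γ₂)` to `ξ(γ₁ γ₂)` whenever `γ₁`, `γ₂` are composable. -/
structure IsLeftInvariant {n : ℕ} (ξ : E n × E n → E n × E n) : Prop where
  smooth : ContDiffOn ℝ ∞ ξ (TS n)
  tangent : ∀ γ ∈ TS n, ∃ c, Represents c γ (ξ γ)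
  invariant : ∀ γ₃ γ₁ γ₂, Mul γ₃ γ₁ γ₂ →
    ∃ c d : ℝ → E n × E n, Represents c γ₂ (ξ γ₂) ∧ (∀ t, Mul (d t) γ₁ (c t)) ∧
      Represents d γ₃ (ξ γ₃)

/-- `ξ` is a left-invariant vector field on `S̃` which extends the section `X`. -/
def IsLeftInvariantExtension {n : ℕ} (X : E n → E n) (ξ : E n × E n → E n × E n) : Prop :=
  IsLeftInvariant ξ ∧ ∀ p ∈ S n, ξ (p, 0) = vert (X p)

/-- The left-invariant vector field on `S̃` extending the section `X`. -/
def leftInvariantExtension {n : ℕ} (X : E n → E n) : E n × E n → E n × E n :=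
  Classical.epsilon (IsLeftInvariantExtension X)

/-- The bracket `[X, Y](p)` of the Lie algebroid of `S̃`: the value at the unit `(p, 0)` of the Lie
bracket of the left-invariant vector fields on the submanifold `TSⁿ` which extend `X` and `Y`.
(For vector fields tangent to a submanifold, `lieBracketWithin` only differentiates along it.) -/
def bracket {n : ℕ} (X Y : E n → E n) (p : E n) : E n × E n :=
  VectorField.lieBracketWithin ℝ (leftInvariantExtension X) (leftInvariantExtension Y) (TS n)
    (p, 0)

/-- The anchor `TSⁿ → TSⁿ` of the Lie algebroid of `S̃`: the tangent map of `e_R`, applied to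
vectors tangent to the left fibers at the units. -/
def anchor {n : ℕ} (γ : E n × E n) : E n × E n :=
  (eR (γ.1, 0), fderivWithin ℝ eR (TS n) (γ.1, 0) (vert γ.2))

/-- The projection `P_p(w) = w - (w · p) p` of `ℝⁿ⁺¹` onto `T_p Sⁿ`. -/
def P {n : ℕ} (p w : E n) : E n := w - inner ℝ w p • p

/-- The section `Ỹ_i(p) = P_p(e_i)`. -/
def Ytilde {n : ℕ} (i : Fin (n + 1)) (p : E n) : E n := P p (e i)

/-- `δ_{i,n+1}`. -/
def δlast {n : ℕ} (i : Fin (n + 1)) : ℝ := if i = Fin.last n then 1 else 0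

end

end EuclideanLines

open EuclideanLines

namespace EuclideanLines

noncomputable section

open Matrix

variable {n : ℕ}

/-! Everything reduces to explicit formulas for the groupoid, obtained by letting $G$ act on
Minkowski space. An element $\gamma=(p,v)$ of $\tilde S$ is the class of some $b(1,y)$ with
$p=bp_0$, $v=b(y,0)$. Rewriting $b(1,y)=c'b'$ in the order $CB$ gives the right unit $b'p_0=$ `tgt
γ` and an isometry `transport γ` $=b'b^{-1}$ from $T_p$ onto the tangent space at `tgt γ`. The
decomposition exists by `exists_frame` and is computed by `frame_eq_of_mul_eq`. Since
$(1,y)(1,y')=(1,y+y')$, the product becomes $(p,v)\cdot(\mathtt{tgt}\,\gamma,\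
\mathtt{transport}\,\gamma\,x)=(p,v+x)$, which is `mul_iff`.

Hence left translation is linear on left fibers, and the left-invariant extension of $X$ can only be
$\gamma\mapsto(0,\ (\mathtt{transport}\,\gamma)^{-1}X(\mathtt{tgt}\,\gamma))$. Functoriality,
`transport_mul`, shows that this field is indeed left-invariant. The inverse isometry is an adjoint,
`transportInv`, whose closed formula gives smoothness.

Differentiating along fibers at the units yields the anchor (`hasDerivAt_tgt`) and a bracket formula
for arbitrary sections (`bracket_eq`). Claims 3 and 5 are evaluations of it; claims 1 and 2 are
linear algebra of the projection $P_p$. -/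

/-! ### Coordinates on Minkowski space -/

/-- The vector `(a, w)` of Minkowski space. -/
def vec (a : ℝ) (w : E n) : Unit ⊕ Fin (n + 1) → ℝ := Sum.elim (fun _ => a) w

theorem vec_inj {a a' : ℝ} {w w' : E n} : vec a w = vec a' w' ↔ a = a' ∧ w = w' := by
  constructor
  · intro h
    refine ⟨congrFun h (Sum.inl ()), ?_⟩
    ext i
    exact congrFun h (Sum.inr i)
  · rintro ⟨rfl, rfl⟩; rfl

theorem exists_eq_vec (x : Unit ⊕ Fin (n + 1) → ℝ) : ∃ a, ∃ w : E n, x = vec a w := by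
  refine ⟨x (Sum.inl ()), WithLp.toLp 2 fun i => x (Sum.inr i), ?_⟩
  ext i
  rcases i with i | i <;> simp [vec]

theorem ext_of_mulVec_vec {M M' : Mat n} (h : ∀ a (w : E n), M *ᵥ vec a w = M' *ᵥ vec a w) :
    M = M' := by
  apply Matrix.mulVec_injective
  ext x : 1
  obtain ⟨a, w, rfl⟩ := exists_eq_vec x
  exact h a w

theorem matB_mulVec (b : Matrix (Fin (n + 1)) (Fin (n + 1)) ℝ) (a : ℝ) (w : E n) :
    matB b *ᵥ vec a w = vec a (toEuclideanLin b w) := by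
  ext i
  rcases i with i | i <;>
    simp [matB, vec, Matrix.fromBlocks_mulVec, toLpLin_apply, Function.comp_def]

theorem pad_castSucc (y : EuclideanSpace ℝ (Fin n)) (i : Fin n) : pad y i.castSucc = y i := by
  simp [pad]

theorem pad_last (y : EuclideanSpace ℝ (Fin n)) : pad y (Fin.last n) = 0 := by
  simp [pad]

theorem p₀_castSucc (i : Fin n) : p₀ n i.castSucc = 0 := by
  simp [p₀, e, (Fin.castSucc_lt_last i).ne]

theorem p₀_last : p₀ n (Fin.last n) = 1 := by
  simp [p₀, e]

theorem inner_p₀ (w : E n) : inner ℝ (p₀ n) w = w (Fin.last n) := by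
  simp [p₀, e, EuclideanSpace.inner_single_left]

theorem inner_p₀_right (w : E n) : inner ℝ w (p₀ n) = w (Fin.last n) := by
  rw [real_inner_comm, inner_p₀]

theorem norm_p₀ : ‖p₀ n‖ = 1 := by simp [p₀, e]

theorem inner_pad (y : EuclideanSpace ℝ (Fin n)) (w : E n) :
    inner ℝ (pad y) w = ∑ i, y i * w i.castSucc := by
  simp only [PiLp.inner_apply, Fin.sum_univ_castSucc, pad_castSucc, pad_last]
  simp [mul_comm]

theorem inner_pad_pad (y z : EuclideanSpace ℝ (Fin n)) :
    inner ℝ (pad y) (pad z) = inner ℝ y z := by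
  rw [inner_pad]; simp [PiLp.inner_apply, mul_comm, pad_castSucc]

theorem norm_pad (y : EuclideanSpace ℝ (Fin n)) : ‖pad y‖ = ‖y‖ := by
  rw [← sq_eq_sq₀ (norm_nonneg _) (norm_nonneg _), ← real_inner_self_eq_norm_sq,
    ← real_inner_self_eq_norm_sq, inner_pad_pad]

theorem pad_add (y z : EuclideanSpace ℝ (Fin n)) : pad (y + z) = pad y + pad z := by
  ext i; refine Fin.lastCases ?_ (fun i => ?_) i <;> simp [pad_castSucc, pad_last]

theorem pad_smul (t : ℝ) (z : EuclideanSpace ℝ (Fin n)) : pad (t • z) = t • pad z := by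
  ext i; refine Fin.lastCases ?_ (fun i => ?_) i <;> simp [pad_castSucc, pad_last]

theorem pad_zero : pad (0 : EuclideanSpace ℝ (Fin n)) = 0 := by
  simpa using pad_smul 0 (0 : EuclideanSpace ℝ (Fin n))

/-- A vector orthogonal to `p₀` comes from `ℝⁿ`. -/
theorem exists_eq_pad {w : E n} (hw : w (Fin.last n) = 0) : ∃ y, w = pad y := by
  refine ⟨WithLp.toLp 2 fun i => w i.castSucc, ?_⟩
  ext i; refine Fin.lastCases ?_ (fun i => ?_) i <;> simp [pad_castSucc, pad_last, hw]

theorem exists_eq_pad_add (w : E n) : ∃ y, w = pad y + w (Fin.last n) • p₀ n := by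
  obtain ⟨y, hy⟩ := exists_eq_pad (w := w - w (Fin.last n) • p₀ n) (by simp [p₀_last])
  exact ⟨y, by rw [← hy]; abel⟩

/-! ### The group $C$ and its action on Minkowski space -/

/-- The coefficient of `p₀` in the action of `matC s y`. -/
def kappa (s : ℝ) (y : EuclideanSpace ℝ (Fin n)) (a : ℝ) (w : E n) : ℝ :=
  (s ^ 2 - 1 - ‖y‖ ^ 2) / (2 * s) * a + inner ℝ (pad y) w / s +
    ((s ^ 2 + 1 - ‖y‖ ^ 2) / (2 * s) - 1) * w (Fin.last n)

/-- The null coordinate $a+w^{n+1}$ is multiplied by $s$, and all the quadratic terms are gathered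
in `kappa`. Later computations use this form instead of matrix entries. -/
theorem matC_mulVec {s : ℝ} (hs : 0 < s) (y : EuclideanSpace ℝ (Fin n)) (a : ℝ) (w : E n) :
    matC s y *ᵥ vec a w =
      vec (a + (s - 1) * (a + w (Fin.last n)) - kappa s y a w)
        (w - (a + w (Fin.last n)) • pad y + kappa s y a w • p₀ n) := by
  have hsum : inner ℝ (pad y) w = ∑ i, y i * w i.castSucc := inner_pad y w
  ext i
  rcases i with i | i
  · simp [matC, vec, Matrix.mulVec, dotProduct, Fin.sum_univ_castSucc,
      kappa, hsum, Finset.sum_div]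
    have : ∑ x : Fin n, y x / s * w x.castSucc = ∑ x : Fin n, y x * w x.castSucc / s := by
      congr 1; ext; ring
    rw [this]
    field_simp
    ring
  · refine Fin.lastCases ?_ (fun i => ?_) i
    · simp [matC, vec, Matrix.mulVec, dotProduct,
        Fin.sum_univ_castSucc, kappa, hsum, pad_last, p₀_last, Finset.sum_div]
      have : ∑ x : Fin n, y x / s * w x.castSucc = ∑ x : Fin n, y x * w x.castSucc / s := by
        congr 1; ext; ring
      rw [this]
      ring
    · simp [matC, vec, Matrix.mulVec, dotProduct,
        Fin.sum_univ_castSucc, pad_castSucc, p₀_castSucc, Pi.single_apply]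
      ring

theorem last_sub_smul_pad_add (w : E n) (y : EuclideanSpace ℝ (Fin n)) (t k : ℝ) :
    (w - t • pad y + k • p₀ n) (Fin.last n) = w (Fin.last n) + k := by
  simp [pad_last, p₀_last]

theorem matC_mul {s s' : ℝ} (hs : 0 < s) (hs' : 0 < s') (y y' : EuclideanSpace ℝ (Fin n)) :
    matC s y * matC s' y' = matC (s * s') (s' • y + y') := by
  apply ext_of_mulVec_vec
  intro a w
  have h1 : ‖s' • y + y'‖ ^ 2 = s' ^ 2 * ‖y‖ ^ 2 + 2 * s' * inner ℝ y y' + ‖y'‖ ^ 2 := by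
    rw [norm_add_sq_real, norm_smul, inner_smul_left, mul_pow, Real.norm_eq_abs, sq_abs]
    simp; ring
  rw [← Matrix.mulVec_mulVec, matC_mulVec hs', matC_mulVec hs, matC_mulVec (mul_pos hs hs')]
  -- The coefficients of $p_0$ add up under composition; once this is known, the rest of the group
  -- law is linear.
  have hk : kappa s' y' a w + kappa s y (a + (s' - 1) * (a + w (Fin.last n)) - kappa s' y' a w)
      (w - (a + w (Fin.last n)) • pad y' + kappa s' y' a w • p₀ n) =
      kappa (s * s') (s' • y + y') a w := by
    simp only [kappa, last_sub_smul_pad_add, pad_add, pad_smul, inner_add_left, inner_add_right,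
      inner_sub_right, inner_smul_left, inner_smul_right, inner_p₀_right, pad_last, h1,
      inner_pad_pad]
    simp
    field_simp
    ring
  rw [vec_inj, ← hk, last_sub_smul_pad_add, pad_add, pad_smul]
  constructor
  · ring
  · module

theorem matC_one_zero : matC 1 (0 : EuclideanSpace ℝ (Fin n)) = 1 := by
  apply ext_of_mulVec_vec
  intro a w
  rw [matC_mulVec one_pos, Matrix.one_mulVec, vec_inj]
  simp [kappa, pad_zero]

theorem matC_inv_mul {s : ℝ} (hs : 0 < s) (y : EuclideanSpace ℝ (Fin n)) :
    matC s⁻¹ (-s⁻¹ • y) * matC s y = 1 := by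
  rw [matC_mul (inv_pos.2 hs) hs, inv_mul_cancel₀ hs.ne', smul_smul, mul_neg,
    mul_inv_cancel₀ hs.ne', neg_one_smul, neg_add_cancel, matC_one_zero]

theorem matC_mul_inv {s : ℝ} (hs : 0 < s) (y : EuclideanSpace ℝ (Fin n)) :
    matC s y * matC s⁻¹ (-s⁻¹ • y) = 1 :=
  mul_eq_one_comm.1 (matC_inv_mul hs y)

/-- Every element of $C$ has a square root in $C$, namely $(\sqrt s,\,y/(1+\sqrt s))$, so its
determinant is a square, nonzero by invertibility. -/
theorem det_matC_pos {s : ℝ} (hs : 0 < s) (y : EuclideanSpace ℝ (Fin n)) :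
    0 < (matC s y).det := by
  have ht : 0 < √s := Real.sqrt_pos.2 hs
  have h : matC s y = matC (√s) ((1 + √s)⁻¹ • y) * matC (√s) ((1 + √s)⁻¹ • y) := by
    rw [matC_mul ht ht, Real.mul_self_sqrt hs.le, smul_smul, ← add_smul]
    have : √s * (1 + √s)⁻¹ + (1 + √s)⁻¹ = 1 := by field_simp; ring
    rw [this, one_smul]
  have hne : (matC s y).det ≠ 0 := by
    intro h0
    have := congrArg Matrix.det (matC_inv_mul hs y)
    simp [h0] at this
  have h2 := congrArg Matrix.det h
  rw [Matrix.det_mul] at h2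
  exact lt_of_le_of_ne (h2 ▸ mul_self_nonneg _) hne.symm

/-! ### Lorentz invariance, orthogonal matrices and uniqueness of the $BC$ decomposition -/

/-- The Lorentz form, with signature `(-, +, …, +)`. -/
def lorentz (x : Unit ⊕ Fin (n + 1) → ℝ) : ℝ :=
  -x (Sum.inl ()) ^ 2 + ∑ i, x (Sum.inr i) ^ 2

theorem lorentz_vec (a : ℝ) (w : E n) : lorentz (vec a w) = -a ^ 2 + ‖w‖ ^ 2 := by
  simp [lorentz, vec, EuclideanSpace.norm_sq_eq]

theorem norm_sub_smul_pad_add_sq (w : E n) (y : EuclideanSpace ℝ (Fin n)) (t k : ℝ) :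
    ‖w - t • pad y + k • p₀ n‖ ^ 2 = ‖w‖ ^ 2 + t ^ 2 * ‖y‖ ^ 2 + k ^ 2 -
      2 * t * inner ℝ (pad y) w + 2 * k * w (Fin.last n) := by
  simp only [← real_inner_self_eq_norm_sq, inner_add_left, inner_add_right, inner_sub_left,
    inner_sub_right, inner_smul_left, inner_smul_right, inner_p₀_right, inner_p₀, pad_last,
    inner_pad_pad, real_inner_comm (pad y) w, p₀_last, conj_trivial]
  ring

theorem lorentz_matC {s : ℝ} (hs : 0 < s) (y : EuclideanSpace ℝ (Fin n))
    (x : Unit ⊕ Fin (n + 1) → ℝ) : lorentz (matC s y *ᵥ x) = lorentz x := by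
  obtain ⟨a, w, rfl⟩ := exists_eq_vec x
  rw [matC_mulVec hs, lorentz_vec, lorentz_vec, norm_sub_smul_pad_add_sq]
  simp only [kappa]
  field_simp
  ring

theorem norm_toEuclideanLin {b : Matrix (Fin (n + 1)) (Fin (n + 1)) ℝ}
    (hb : b ∈ orthogonalGroup (Fin (n + 1)) ℝ) (w : E n) : ‖toEuclideanLin b w‖ = ‖w‖ := by
  have h : bᵀ * b = 1 := by
    simpa [Matrix.star_eq_conjTranspose] using (mem_orthogonalGroup_iff' (Fin (n+1)) ℝ).1 hb
  rw [← sq_eq_sq₀ (norm_nonneg _) (norm_nonneg _), ← real_inner_self_eq_norm_sq,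
    ← real_inner_self_eq_norm_sq]
  simp only [toLpLin_apply, EuclideanSpace.inner_eq_star_dotProduct, star_trivial]
  rw [Matrix.dotProduct_mulVec, ← Matrix.mulVec_transpose, Matrix.mulVec_mulVec, h,
    Matrix.one_mulVec]

theorem inner_toEuclideanLin {b : Matrix (Fin (n + 1)) (Fin (n + 1)) ℝ}
    (hb : b ∈ orthogonalGroup (Fin (n + 1)) ℝ) (w w' : E n) :
    inner ℝ (toEuclideanLin b w) (toEuclideanLin b w') = inner ℝ w w' :=
  LinearIsometry.inner_map_map ⟨toEuclideanLin b, norm_toEuclideanLin hb⟩ w w'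

theorem mem_orthogonalGroup_of_norm {b : Matrix (Fin (n + 1)) (Fin (n + 1)) ℝ}
    (hb : ∀ w : E n, ‖toEuclideanLin b w‖ = ‖w‖) : b ∈ orthogonalGroup (Fin (n + 1)) ℝ := by
  rw [mem_orthogonalGroup_iff']
  have key (i j) : inner ℝ (toEuclideanLin b (e i)) (toEuclideanLin b (e j)) =
      inner ℝ (e (n := n) i) (e j) :=
    LinearIsometry.inner_map_map ⟨toEuclideanLin b, hb⟩ _ _
  ext i j
  have := key i j
  simp [toLpLin_apply, e, PiLp.inner_apply, Matrix.mulVec_single] at this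
  simpa [Matrix.mul_apply, Matrix.one_apply, mul_comm] using this

theorem toEuclideanLin_mul (b b' : Matrix (Fin (n + 1)) (Fin (n + 1)) ℝ) (w : E n) :
    toEuclideanLin (b * b') w = toEuclideanLin b (toEuclideanLin b' w) := by
  simp [toLpLin_apply, Matrix.mulVec_mulVec]

theorem toEuclideanLin_transpose_apply {b : Matrix (Fin (n + 1)) (Fin (n + 1)) ℝ}
    (hb : b ∈ orthogonalGroup (Fin (n + 1)) ℝ) (w : E n) :
    toEuclideanLin b (toEuclideanLin bᵀ w) = w := by
  have h : b * bᵀ = 1 := by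
    simpa [Matrix.star_eq_conjTranspose] using (mem_orthogonalGroup_iff (Fin (n+1)) ℝ).1 hb
  rw [← toEuclideanLin_mul, h]
  simp

theorem matB_injective : Function.Injective (matB (n := n)) := fun _ _ h =>
  (Matrix.fromBlocks_inj.1 h).2.2.2

/-- Elements of $B$ preserve the time component, so the time row of $b(s,y)$ is that of $(s,y)$. Its
value on the null vector $(1,-p_0)$ is $1/s$, and on $(0,e_i)$, $i\le n$, it is $-y_i/s$. -/
theorem matB_mul_matC_inj {b b' : Matrix (Fin (n + 1)) (Fin (n + 1)) ℝ} {s s' : ℝ} (hs : 0 < s)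
    (hs' : 0 < s') {y y' : EuclideanSpace ℝ (Fin n)}
    (h : matB b * matC s y = matB b' * matC s' y') : b = b' ∧ s = s' ∧ y = y' := by
  have hrow (a : ℝ) (w : E n) : a + (s - 1) * (a + w (Fin.last n)) - kappa s y a w =
      a + (s' - 1) * (a + w (Fin.last n)) - kappa s' y' a w := by
    have := congrArg (· *ᵥ vec a w) h
    simp only [← Matrix.mulVec_mulVec, matC_mulVec hs, matC_mulVec hs', matB_mulVec,
      vec_inj] at this
    exact this.1
  have h1 : s = s' := by
    have h1 := hrow 1 (-p₀ n)
    simp [kappa, p₀_last, inner_p₀_right, pad_last] at h1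
    field_simp at h1
    linarith
  subst h1
  have h2 : y = y' := by
    ext i
    have h2 := hrow 0 (e i.castSucc)
    simp [kappa, e, (Fin.castSucc_lt_last i).ne', EuclideanSpace.inner_single_right,
      pad_castSucc] at h2
    field_simp at h2
    exact h2
  subst h2
  refine ⟨?_, rfl, rfl⟩
  apply matB_injective
  have := congrArg (· * matC s⁻¹ (-s⁻¹ • y)) h
  simpa only [mul_assoc, matC_mul_inv hs, mul_one] using this

theorem det_matB (b : Matrix (Fin (n + 1)) (Fin (n + 1)) ℝ) : (matB b).det = b.det := by
  simp [matB]

/-- A Lorentz matrix of positive determinant which fixes `(1, 0)` lies in `B`. -/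
theorem exists_matB_of_lorentz {g : Mat n} (hdet : 0 < g.det)
    (hg : ∀ x, lorentz (g *ᵥ x) = lorentz x) (hfix : g *ᵥ vec 1 0 = vec 1 0) :
    ∃ b ∈ specialOrthogonalGroup (Fin (n + 1)) ℝ, g = matB b := by
  have htime (a : ℝ) (w : E n) : ∃ w', g *ᵥ vec a w = vec a w' ∧ ‖w'‖ = ‖w‖ := by
    obtain ⟨a', w', h⟩ := exists_eq_vec (g *ᵥ vec a w)
    have h1 := hg (vec a w)
    -- Adding the fixed vector $(1,0)$ changes the Lorentz form by $-2a-1$, so invariance of the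
    -- form forces invariance of the time component.
    have h2 := hg (vec a w + vec 1 0)
    have hadd (a : ℝ) (w : E n) : vec a w + vec 1 0 = vec (a + 1) w := by
      ext i; rcases i with i | i <;> simp [vec]
    rw [Matrix.mulVec_add, hfix, h, hadd, hadd, lorentz_vec, lorentz_vec] at h2
    rw [h, lorentz_vec, lorentz_vec] at h1
    have h3 : a' = a := by linarith
    subst h3
    exact ⟨w', h, by rw [← sq_eq_sq₀ (norm_nonneg _) (norm_nonneg _)]; linarith⟩
  choose f hf hfn using htime
  have hgb : g = matB g.toBlocks₂₂ := by
    apply ext_of_mulVec_vec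
    intro a w
    have ha : vec a w = a • vec 1 0 + vec 0 w := by
      ext i; rcases i with i | i <;> simp [vec]
    have hz : g *ᵥ vec 0 w = matB g.toBlocks₂₂ *ᵥ vec 0 w := by
      rw [hf, matB_mulVec, vec_inj]
      refine ⟨rfl, ?_⟩
      ext i
      have := congrFun (hf 0 w) (Sum.inr i)
      simp only [vec, Sum.elim_inr] at this
      rw [← this]
      simp [Matrix.mulVec, dotProduct, toLpLin_apply, toBlocks₂₂]
    rw [ha, Matrix.mulVec_add, Matrix.mulVec_add, Matrix.mulVec_smul, Matrix.mulVec_smul, hfix, hz,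
      matB_mulVec _ 1 0, map_zero]
  have horth : g.toBlocks₂₂ ∈ orthogonalGroup (Fin (n + 1)) ℝ := by
    apply mem_orthogonalGroup_of_norm
    intro w
    have := hf 0 w
    rw [hgb, matB_mulVec, vec_inj] at this
    rw [this.2, hfn]
  refine ⟨g.toBlocks₂₂, mem_specialOrthogonalGroup_iff.2 ⟨horth, ?_⟩, hgb⟩
  have h1 : g.toBlocks₂₂.det * g.toBlocks₂₂.det = 1 := by
    have := congrArg Matrix.det ((mem_orthogonalGroup_iff (Fin (n+1)) ℝ).1 horth)
    simpa [Matrix.star_eq_conjTranspose] using this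
  rw [hgb, det_matB] at hdet
  rcases mul_self_eq_one_iff.1 h1 with h | h
  · exact h
  · linarith

/-- `SO(n+1)` acts transitively on the sphere. -/
theorem exists_specialOrthogonal (hn : 1 ≤ n) {p : E n} (hp : p ∈ S n) :
    ∃ b ∈ specialOrthogonalGroup (Fin (n + 1)) ℝ, toEuclideanLin b (p₀ n) = p := by
  have hpn : ‖p₀ n‖ = ‖p‖ := by
    rw [norm_p₀]; simpa [S] using hp.symm
  obtain ⟨b, hb, hbp⟩ : ∃ b ∈ orthogonalGroup (Fin (n + 1)) ℝ, toEuclideanLin b (p₀ n) = p := by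
    -- The reflection in the hyperplane orthogonal to $p_0-p$ exchanges the two unit vectors (it is
    -- the identity if $p=p_0$).
    let f := (Submodule.span ℝ {p₀ n - p})ᗮ.reflection
    refine ⟨toEuclideanLin.symm f.toLinearEquiv.toLinearMap, ?_, ?_⟩
    · apply mem_orthogonalGroup_of_norm
      intro w
      simp
    · simpa [f] using Submodule.reflection_sub hpn
  have h1 : b.det * b.det = 1 := by
    have := congrArg Matrix.det ((mem_orthogonalGroup_iff (Fin (n+1)) ℝ).1 hb)
    simpa [Matrix.star_eq_conjTranspose] using this
  rcases mul_self_eq_one_iff.1 h1 with h | h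
  · exact ⟨b, mem_specialOrthogonalGroup_iff.2 ⟨hb, h⟩, hbp⟩
  -- The determinant is corrected by a sign change of the first coordinate, which fixes $p_0$
  -- because $n\ge1$.
  · let D : Matrix (Fin (n + 1)) (Fin (n + 1)) ℝ := diagonal (Function.update 1 0 (-1))
    have hD : D ∈ orthogonalGroup (Fin (n + 1)) ℝ := by
      rw [mem_orthogonalGroup_iff]
      ext i j
      by_cases hi : i = 0 <;> by_cases hij : i = j <;>
        simp_all [D, Function.update_apply, Matrix.one_apply]
    refine ⟨b * D, mem_specialOrthogonalGroup_iff.2 ⟨mul_mem hb hD, ?_⟩, ?_⟩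
    · rw [Matrix.det_mul, h]
      simp [D, Matrix.det_diagonal, Finset.prod_update_of_mem]
    · rw [toEuclideanLin_mul]
      have : toEuclideanLin D (p₀ n) = p₀ n := by
        have hl : Fin.last n ≠ 0 := by
          intro h; have := congrArg Fin.val h; simp at this; omega
        ext i
        by_cases hi : i = Fin.last n <;>
          simp_all [D, toLpLin_apply, p₀, e]
      rw [this, hbp]

/-! ### Explicit right projection and transport, and the $CB$ decomposition -/

theorem mem_T_iff {p v : E n} : v ∈ T p ↔ inner ℝ p v = 0 :=
  Submodule.mem_orthogonal_singleton_iff_inner_right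

theorem mem_S_iff {p : E n} : p ∈ S n ↔ ‖p‖ = 1 := by simp [S]

/-- The vector `v + (|v|² / 2) (p - p₀)`. -/
def shift (γ : E n × E n) : E n := γ.2 + (‖γ.2‖ ^ 2 / 2) • (γ.1 - p₀ n)

/-- The component `s` of the right factor in the decomposition of `G` as `CB`. -/
def scale (γ : E n × E n) : ℝ := 1 - shift γ (Fin.last n)

/-- The right projection, explicitly. -/
def tgt (γ : E n × E n) : E n :=
  γ.1 + ((γ.1 (Fin.last n) - 1) / scale γ) • shift γ

/-- An auxiliary linear map in the definition of `transport`. -/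
def shear (γ : E n × E n) (x : E n) : E n := x + inner ℝ γ.2 x • (γ.1 - p₀ n)

/-- The isometry from `T_p Sⁿ` onto the tangent space at the right projection of `γ = (p, v)`
which is induced by left translation by the inverse of `γ`. -/
def transport (γ : E n × E n) (x : E n) : E n :=
  shear γ x + (shear γ x (Fin.last n) / scale γ) • shift γ

theorem sq_last_le (w : E n) : w (Fin.last n) ^ 2 ≤ ‖w‖ ^ 2 := by
  rw [EuclideanSpace.norm_sq_eq]
  simpa using Finset.single_le_sum (f := fun i => ‖w i‖ ^ 2) (fun i _ => sq_nonneg _)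
    (Finset.mem_univ (Fin.last n))

theorem norm_add_smul_sq {γ : E n × E n} (hγ : γ ∈ TS n) (t : ℝ) :
    ‖γ.2 + t • γ.1‖ ^ 2 = ‖γ.2‖ ^ 2 + t ^ 2 := by
  have h1 := mem_S_iff.1 hγ.1
  have h2 := mem_T_iff.1 hγ.2
  rw [norm_add_sq_real, inner_smul_right, real_inner_comm, h2, norm_smul, h1, Real.norm_eq_abs,
    mul_one, sq_abs]
  ring

theorem shift_last (γ : E n × E n) : shift γ (Fin.last n) =
    (γ.2 + (‖γ.2‖ ^ 2 / 2) • γ.1) (Fin.last n) - ‖γ.2‖ ^ 2 / 2 := by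
  simp [shift, p₀_last]; ring

/-- With $u=v+\frac{|v|^2}2p$, the scale is $1+\frac{|v|^2}2-u^{n+1}$. As $v\perp p$,
$|u|^2=|v|^2+\frac{|v|^4}4$ is exactly $1$ less than $(1+\frac{|v|^2}2)^2$. -/
theorem scale_pos {γ : E n × E n} (hγ : γ ∈ TS n) : 0 < scale γ := by
  have h1 := sq_last_le (γ.2 + (‖γ.2‖ ^ 2 / 2) • γ.1)
  rw [norm_add_smul_sq hγ] at h1
  rw [scale, shift_last]
  have h2 := abs_le_of_sq_le_sq (a := (γ.2 + (‖γ.2‖ ^ 2 / 2) • γ.1) (Fin.last n))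
    (b := 1 + ‖γ.2‖ ^ 2 / 2) (by nlinarith) (by positivity)
  have h3 : (γ.2 + (‖γ.2‖ ^ 2 / 2) • γ.1) (Fin.last n) ≠ 1 + ‖γ.2‖ ^ 2 / 2 := by
    intro h
    rw [h] at h1
    nlinarith
  have := lt_of_le_of_ne (le_of_abs_le h2) h3
  linarith

theorem kappa_one (y : EuclideanSpace ℝ (Fin n)) (a : ℝ) (w : E n) :
    kappa 1 y a w = inner ℝ (pad y) w - ‖y‖ ^ 2 / 2 * (a + w (Fin.last n)) := by
  simp [kappa]; ring

section Frames

variable {b b' : Matrix (Fin (n + 1)) (Fin (n + 1)) ℝ} {y : EuclideanSpace ℝ (Fin n)}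

theorem frame_mem_TS (hb : b ∈ orthogonalGroup (Fin (n + 1)) ℝ) :
    (toEuclideanLin b (p₀ n), toEuclideanLin b (pad y)) ∈ TS n := by
  refine ⟨mem_S_iff.2 ?_, mem_T_iff.2 ?_⟩
  · rw [norm_toEuclideanLin hb, norm_p₀]
  · rw [inner_toEuclideanLin hb, inner_p₀, pad_last]

theorem frame_mem_T (hb : b ∈ orthogonalGroup (Fin (n + 1)) ℝ) (z : EuclideanSpace ℝ (Fin n)) :
    toEuclideanLin b (pad z) ∈ T (toEuclideanLin b (p₀ n)) :=
  (frame_mem_TS hb).2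

theorem exists_pad_of_mem_T (hb : b ∈ orthogonalGroup (Fin (n + 1)) ℝ) {x : E n}
    (hx : x ∈ T (toEuclideanLin b (p₀ n))) : ∃ z, x = toEuclideanLin b (pad z) := by
  have h := toEuclideanLin_transpose_apply hb x
  obtain ⟨z, hz⟩ := exists_eq_pad (w := toEuclideanLin bᵀ x) (by
    rw [← inner_p₀, ← inner_toEuclideanLin hb, h]
    exact mem_T_iff.1 hx)
  exact ⟨z, by rw [← hz, h]⟩

theorem matB_mul_matC_one_mulVec (a : ℝ) (w : E n) :
    (matB b * matC 1 y) *ᵥ vec a w =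
      vec (a - kappa 1 y a w) (toEuclideanLin b w -
        (a + w (Fin.last n)) • toEuclideanLin b (pad y) +
          kappa 1 y a w • toEuclideanLin b (p₀ n)) := by
  rw [← Matrix.mulVec_mulVec, matC_mulVec one_pos, matB_mulVec]
  simp

/-- The `CB` decomposition of `b (1, y)`. -/
theorem frame_eq_of_mul_eq (hb : b ∈ orthogonalGroup (Fin (n + 1)) ℝ) {s' : ℝ} (hs' : 0 < s')
    {y' : EuclideanSpace ℝ (Fin n)} (h : matB b * matC 1 y = matC s' y' * matB b') :
    toEuclideanLin b' (p₀ n) = tgt (toEuclideanLin b (p₀ n), toEuclideanLin b (pad y)) ∧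
    ∀ z, toEuclideanLin b' (pad z) =
      transport (toEuclideanLin b (p₀ n), toEuclideanLin b (pad y)) (toEuclideanLin b (pad z)) := by
  set γ := (toEuclideanLin b (p₀ n), toEuclideanLin b (pad y)) with hγdef
  have hγ : γ ∈ TS n := frame_mem_TS hb
  have hs := scale_pos hγ
  have hN : ‖γ.2‖ = ‖y‖ := by rw [hγdef, norm_toEuclideanLin hb, norm_pad]
  have key (a : ℝ) (w : E n) := congrArg (· *ᵥ vec a w) h
  simp only [matB_mul_matC_one_mulVec] at key
  simp only [← Matrix.mulVec_mulVec, matB_mulVec, matC_mulVec hs', vec_inj] at key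
  have hp : toEuclideanLin b (p₀ n) = γ.1 := rfl
  have hv : toEuclideanLin b (pad y) = γ.2 := rfl
  simp only [hp, hv] at key
  -- The vector $(1,0)$ is fixed by $b'$, so its image determines $s'$ and $y'$ independently of
  -- $b'$.
  obtain ⟨k1, k2⟩ := key 1 0
  have k3 := congrArg (fun w : E n => w (Fin.last n)) k2
  simp [kappa_one, pad_last, p₀_last] at k1 k2 k3
  have hpad : pad y' = shift γ + (s' - 1) • p₀ n := by
    have : kappa s' y' 1 0 = s' - 1 - ‖y‖ ^ 2 / 2 := by linarith
    rw [this] at k2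
    rw [shift, hN]
    linear_combination (norm := module) (1 : ℝ) • k2
  have hsc : s' = scale γ := by
    have := congrArg (fun w : E n => w (Fin.last n)) hpad
    simp [pad_last, p₀_last] at this
    rw [scale]; linarith
  -- An implicit equation for $b'w$: the right side contains only its last coordinate. Taking last
  -- coordinates then gives a scalar equation with coefficient $1-$ `shift γ (Fin.last n)` $=$
  -- `scale γ`, which is nonzero.
  have main (a : ℝ) (w : E n) : toEuclideanLin b' w =
      (a + toEuclideanLin b' w (Fin.last n)) • shift γ + toEuclideanLin b w -
        (a + w (Fin.last n)) • γ.2 + kappa 1 y a w • (γ.1 - p₀ n) := by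
    obtain ⟨k1, k2⟩ := key a w
    have : kappa s' y' a (toEuclideanLin b' w) =
      (s' - 1) * (a + toEuclideanLin b' w (Fin.last n)) + kappa 1 y a w := by linarith
    rw [this, hpad] at k2
    linear_combination (norm := module) (-1 : ℝ) • k2
  constructor
  · have m := main 0 (p₀ n)
    have m2 := congrArg (fun w : E n => w (Fin.last n)) m
    simp only [kappa_one, p₀_last, inner_p₀_right, pad_last, hp] at m m2
    set x' := toEuclideanLin b' (p₀ n)
    have m3 : x' = γ.1 + (x' (Fin.last n) - 1) • shift γ := by
      conv_lhs => rw [m]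
      rw [shift, hN]; module
    have m4 := congrArg (fun w : E n => w (Fin.last n)) m3
    simp at m4
    have m5 : x' (Fin.last n) - 1 = (γ.1 (Fin.last n) - 1) / scale γ := by
      rw [eq_div_iff hs.ne', scale]; linarith
    rw [m3, m5, tgt]
  · intro z
    have m := main 0 (pad z)
    have hin : inner ℝ (pad y) (pad z) = inner ℝ γ.2 (toEuclideanLin b (pad z)) :=
      (inner_toEuclideanLin hb _ _).symm
    simp only [kappa_one, pad_last, hin] at m
    set x' := toEuclideanLin b' (pad z)
    set x := toEuclideanLin b (pad z)
    have m3 : x' = shear γ x + x' (Fin.last n) • shift γ := by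
      conv_lhs => rw [m]
      rw [shear]; module
    have m4 := congrArg (fun w : E n => w (Fin.last n)) m3
    simp at m4
    have m5 : x' (Fin.last n) = shear γ x (Fin.last n) / scale γ := by
      rw [eq_div_iff hs.ne', scale]; linarith
    rw [m3, m5, transport]

/-- The factor $c'\in C$ is chosen so that $c'$ and $b(1,y)$ agree on $(1,0)$: $s'$ is the scale and
$y'$ consists of the first $n$ coordinates of $v+\frac{|v|^2}2p$. Then $c'^{-1}b(1,y)$ preserves the
Lorentz form, has positive determinant and fixes $(1,0)$, so it lies in $B$. -/
theorem exists_frame (hb : b ∈ specialOrthogonalGroup (Fin (n + 1)) ℝ)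
    (y : EuclideanSpace ℝ (Fin n)) :
    ∃ s' : ℝ, 0 < s' ∧ ∃ y' : EuclideanSpace ℝ (Fin n),
      ∃ b' ∈ specialOrthogonalGroup (Fin (n + 1)) ℝ, matB b * matC 1 y = matC s' y' * matB b' := by
  obtain ⟨hbo, hbd⟩ := mem_specialOrthogonalGroup_iff.1 hb
  set γ := (toEuclideanLin b (p₀ n), toEuclideanLin b (pad y)) with hγdef
  have hγ : γ ∈ TS n := frame_mem_TS hbo
  have hs := scale_pos hγ
  have hN : ‖γ.2‖ = ‖y‖ := by rw [hγdef, norm_toEuclideanLin hbo, norm_pad]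
  obtain ⟨y', hy'⟩ := exists_eq_pad_add (γ.2 + (‖γ.2‖ ^ 2 / 2) • γ.1)
  refine ⟨scale γ, hs, y', ?_⟩
  set g := matC (scale γ)⁻¹ (-(scale γ)⁻¹ • y') * (matB b * matC 1 y) with hg
  have hu := norm_add_smul_sq hγ (‖γ.2‖ ^ 2 / 2)
  have hsc : scale γ = _ := congrArg (1 - ·) (shift_last γ)
  set ul := (γ.2 + (‖γ.2‖ ^ 2 / 2) • γ.1) (Fin.last n)
  have hn : ‖y'‖ ^ 2 = ‖y‖ ^ 2 + (‖y‖ ^ 2 / 2) ^ 2 - ul ^ 2 := by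
    have h2 := norm_sub_smul_pad_add_sq (0 : E n) y' (-1) ul
    simp at h2
    rw [hy', h2, hN] at hu
    linarith
  have hkap : kappa (scale γ) y' 1 0 = -ul := by
    simp only [kappa, hn, hsc, hN] at hs ⊢
    rw [inner_zero_right, PiLp.zero_apply, zero_div, mul_zero, mul_one, add_zero, add_zero,
      div_eq_iff (by linarith)]
    ring
  have hcol : (matB b * matC 1 y) *ᵥ vec 1 0 = matC (scale γ) y' *ᵥ vec 1 0 := by
    rw [matB_mul_matC_one_mulVec, matC_mulVec hs, vec_inj, hkap, kappa_one]
    simp only [inner_zero_right, PiLp.zero_apply, map_zero]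
    constructor
    · rw [hsc, hN]; ring
    · rw [show toEuclideanLin b (p₀ n) = γ.1 from rfl, show toEuclideanLin b (pad y) = γ.2 from rfl]
      rw [hN] at hy'
      linear_combination (norm := module) (-1 : ℝ) • hy'
  obtain ⟨b', hb', h⟩ := exists_matB_of_lorentz (g := g) (by
      rw [hg, Matrix.det_mul, Matrix.det_mul, det_matB, hbd, one_mul]
      exact mul_pos (det_matC_pos (inv_pos.2 hs) _) (det_matC_pos one_pos _))
    (fun x => by
      obtain ⟨a, w, rfl⟩ := exists_eq_vec x
      rw [hg, ← Matrix.mulVec_mulVec, lorentz_matC (inv_pos.2 hs), ← Matrix.mulVec_mulVec,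
        ← lorentz_matC one_pos y (vec a w)]
      obtain ⟨a, w, h⟩ := exists_eq_vec (matC 1 y *ᵥ vec a w)
      rw [h, matB_mulVec, lorentz_vec, lorentz_vec, norm_toEuclideanLin hbo])
    (by
      rw [hg, ← Matrix.mulVec_mulVec, hcol, Matrix.mulVec_mulVec, matC_inv_mul hs,
        Matrix.one_mulVec])
  refine ⟨b', hb', ?_⟩
  rw [← h, hg, ← mul_assoc, matC_mul_inv hs, one_mul]

end Frames

theorem exists_frame_of_mem_TS (hn : 1 ≤ n) {γ : E n × E n} (hγ : γ ∈ TS n) :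
    ∃ b ∈ specialOrthogonalGroup (Fin (n + 1)) ℝ, ∃ y,
      γ = (toEuclideanLin b (p₀ n), toEuclideanLin b (pad y)) := by
  obtain ⟨b, hb, hbp⟩ := exists_specialOrthogonal hn hγ.1
  have h := hγ.2
  rw [← hbp] at h
  obtain ⟨y, hy⟩ := exists_pad_of_mem_T (mem_specialOrthogonalGroup_iff.1 hb).1 h
  exact ⟨b, hb, y, Prod.ext hbp.symm hy⟩

/-! ### Multiplication of $\tilde S$, units and left fibers -/

/-- The multiplication of `S̃`, explicitly. -/
theorem mul_iff (hn : 1 ≤ n) {γ₃ γ₁ γ₂ : E n × E n} :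
    Mul γ₃ γ₁ γ₂ ↔ γ₁ ∈ TS n ∧ ∃ x ∈ T γ₁.1,
      γ₂ = (tgt γ₁, transport γ₁ x) ∧ γ₃ = (γ₁.1, γ₁.2 + x) := by
  constructor
  · rintro ⟨g₃, g₁, g₂, ⟨_, ⟨b, hb, rfl⟩, _, ⟨s₁, hs₁, y₁, rfl⟩, _, ⟨s₂, hs₂, y₂, rfl⟩, rfl, rfl, rfl⟩,
      ⟨b₃, hb₃, t₃, ht₃, z₃, h₃, e₃⟩, ⟨b₁, hb₁, t₁, ht₁, z₁, h₁, e₁⟩,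
      ⟨b₂, hb₂, t₂, ht₂, z₂, h₂, e₂⟩⟩
    rw [Prod.mk.injEq] at e₁ e₂ e₃
    obtain ⟨rfl, rfl⟩ := e₁
    obtain ⟨rfl, rfl⟩ := e₂
    obtain ⟨rfl, rfl⟩ := e₃
    have hb₁' := (mem_specialOrthogonalGroup_iff.1 hb₁).1
    -- Uniqueness of the $BC$ decomposition aligns the representatives: $g_2=b(1,y_2)$,
    -- $g_1=b_1(1,z_1)$, and therefore $g_3=b_1(1,z_1+y_2)$.
    obtain ⟨rfl, rfl, rfl⟩ := matB_mul_matC_inj hs₂ one_pos h₂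
    rw [h₁, mul_assoc, matC_mul one_pos one_pos] at h₃
    obtain ⟨rfl, -, rfl⟩ := matB_mul_matC_inj (by norm_num) one_pos h₃
    obtain ⟨f₁, f₂⟩ := frame_eq_of_mul_eq hb₁' hs₁ h₁.symm
    refine ⟨frame_mem_TS hb₁', toEuclideanLin b₁ (pad y₂), frame_mem_T hb₁' y₂, ?_, ?_⟩
    · rw [← f₁, ← f₂]
    · simp [pad_add]
  · rintro ⟨h₁, x, hx, rfl, rfl⟩
    obtain ⟨b₁, hb₁, y₁, rfl⟩ := exists_frame_of_mem_TS hn h₁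
    have hb₁' := (mem_specialOrthogonalGroup_iff.1 hb₁).1
    obtain ⟨y₂, rfl⟩ := exists_pad_of_mem_T hb₁' hx
    obtain ⟨s, hs, y, b, hb, h⟩ := exists_frame hb₁ y₁
    obtain ⟨f₁, f₂⟩ := frame_eq_of_mul_eq hb₁' hs h
    refine ⟨matC s y * matB b * matC 1 y₂, matC s y * matB b, matB b * matC 1 y₂,
      ⟨_, ⟨b, hb, rfl⟩, _, ⟨s, hs, y, rfl⟩, _, ⟨1, one_pos, y₂, rfl⟩, rfl, rfl, rfl⟩,
      ⟨b₁, hb₁, 1, one_pos, y₁ + y₂, ?_, ?_⟩, ⟨b₁, hb₁, 1, one_pos, y₁, h.symm, rfl⟩,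
      ⟨b, hb, 1, one_pos, y₂, rfl, ?_⟩⟩
    · rw [← h, mul_assoc, matC_mul one_pos one_pos, one_smul, one_mul]
    · simp [pad_add]
    · rw [f₁, f₂]

section

variable {γ : E n × E n}

theorem tgt_mem_S (hn : 1 ≤ n) (hγ : γ ∈ TS n) : tgt γ ∈ S n := by
  obtain ⟨b₁, hb₁, y₁, rfl⟩ := exists_frame_of_mem_TS hn hγ
  obtain ⟨s, hs, y, b, hb, h⟩ := exists_frame hb₁ y₁
  rw [← (frame_eq_of_mul_eq (mem_specialOrthogonalGroup_iff.1 hb₁).1 hs h).1]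
  exact (frame_mem_TS (y := 0) (mem_specialOrthogonalGroup_iff.1 hb).1).1

/-- Invisible in the formula for `transport`, but clear in frames: on $T_p$ it is the restriction of
the orthogonal map $b\,b_1^{-1}$. -/
theorem inner_transport (hn : 1 ≤ n) (hγ : γ ∈ TS n) {x x' : E n} (hx : x ∈ T γ.1)
    (hx' : x' ∈ T γ.1) : inner ℝ (transport γ x) (transport γ x') = inner ℝ x x' := by
  obtain ⟨b₁, hb₁, y₁, rfl⟩ := exists_frame_of_mem_TS hn hγ
  obtain ⟨s, hs, y, b, hb, h⟩ := exists_frame hb₁ y₁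
  have hb₁' := (mem_specialOrthogonalGroup_iff.1 hb₁).1
  obtain ⟨z, rfl⟩ := exists_pad_of_mem_T hb₁' hx
  obtain ⟨z', rfl⟩ := exists_pad_of_mem_T hb₁' hx'
  have f := (frame_eq_of_mul_eq hb₁' hs h).2
  rw [← f, ← f, inner_toEuclideanLin (mem_specialOrthogonalGroup_iff.1 hb).1,
    inner_toEuclideanLin hb₁']

theorem exists_transport_eq (hn : 1 ≤ n) (hγ : γ ∈ TS n) {w : E n} (hw : w ∈ T (tgt γ)) :
    ∃ x ∈ T γ.1, transport γ x = w := by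
  obtain ⟨b₁, hb₁, y₁, rfl⟩ := exists_frame_of_mem_TS hn hγ
  obtain ⟨s, hs, y, b, hb, h⟩ := exists_frame hb₁ y₁
  have hb₁' := (mem_specialOrthogonalGroup_iff.1 hb₁).1
  obtain ⟨f₁, f₂⟩ := frame_eq_of_mul_eq hb₁' hs h
  rw [← f₁] at hw
  obtain ⟨z, rfl⟩ := exists_pad_of_mem_T (mem_specialOrthogonalGroup_iff.1 hb).1 hw
  exact ⟨_, frame_mem_T hb₁' z, (f₂ z).symm⟩

theorem transport_mem_T (hn : 1 ≤ n) (hγ : γ ∈ TS n) {x : E n} (hx : x ∈ T γ.1) :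
    transport γ x ∈ T (tgt γ) := by
  obtain ⟨b₁, hb₁, y₁, rfl⟩ := exists_frame_of_mem_TS hn hγ
  obtain ⟨s, hs, y, b, hb, h⟩ := exists_frame hb₁ y₁
  have hb₁' := (mem_specialOrthogonalGroup_iff.1 hb₁).1
  obtain ⟨z, rfl⟩ := exists_pad_of_mem_T hb₁' hx
  obtain ⟨f₁, f₂⟩ := frame_eq_of_mul_eq hb₁' hs h
  rw [← f₁, ← f₂]
  exact (frame_mem_TS (mem_specialOrthogonalGroup_iff.1 hb).1).2

/-- Functoriality of the right projection and of the transport. -/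
theorem transport_mul (hn : 1 ≤ n) (hγ : γ ∈ TS n) {x : E n} (hx : x ∈ T γ.1) :
    tgt (tgt γ, transport γ x) = tgt (γ.1, γ.2 + x) ∧
    ∀ w ∈ T γ.1, transport (tgt γ, transport γ x) (transport γ w) =
      transport (γ.1, γ.2 + x) w := by
  obtain ⟨b₁, hb₁, y₁, rfl⟩ := exists_frame_of_mem_TS hn hγ
  have hb₁' := (mem_specialOrthogonalGroup_iff.1 hb₁).1
  obtain ⟨y₂, rfl⟩ := exists_pad_of_mem_T hb₁' hx
  obtain ⟨s, hs, y, b, hb, h⟩ := exists_frame hb₁ y₁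
  obtain ⟨s', hs', y', b', hb', h'⟩ := exists_frame hb y₂
  obtain ⟨f₁, f₂⟩ := frame_eq_of_mul_eq hb₁' hs h
  obtain ⟨f₁', f₂'⟩ := frame_eq_of_mul_eq (mem_specialOrthogonalGroup_iff.1 hb).1 hs' h'
  -- Two successive $CB$ decompositions give that of the product, by associativity in $G$;
  -- uniqueness of its $B$ part is functoriality.
  have h'' : matB b₁ * matC 1 (y₁ + y₂) = matC (s * s') (s' • y + y') * matB b' := by
    rw [← matC_mul hs hs', mul_assoc, ← h', ← mul_assoc, ← h, mul_assoc, matC_mul one_pos one_pos,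
      one_smul, one_mul]
  obtain ⟨g₁, g₂⟩ := frame_eq_of_mul_eq hb₁' (mul_pos hs hs') h''
  rw [pad_add, map_add] at g₁ g₂
  rw [← f₁, ← f₂]
  refine ⟨f₁'.symm.trans g₁, fun w hw => ?_⟩
  obtain ⟨z, rfl⟩ := exists_pad_of_mem_T hb₁' hw
  rw [← f₂, ← f₂', g₂]

end

theorem shift_zero (p : E n) : shift (p, 0) = 0 := by simp [shift]

theorem scale_zero (p : E n) : scale (p, 0) = 1 := by simp [scale, shift_zero]

theorem tgt_zero (p : E n) : tgt (p, 0) = p := by simp [tgt, shift_zero]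

theorem transport_zero_left (p x : E n) : transport (p, 0) x = x := by
  simp [transport, shift_zero, shear]

theorem transport_zero_right (γ : E n × E n) : transport γ 0 = 0 := by
  simp [transport, shear]

theorem zero_mem_TS {p : E n} (hp : p ∈ S n) : (p, 0) ∈ TS n := ⟨hp, zero_mem _⟩

theorem isLeftUnit_iff (hn : 1 ≤ n) {γ : E n × E n} {q : E n} :
    IsLeftUnit γ q ↔ γ ∈ TS n ∧ q = γ.1 := by
  rw [IsLeftUnit, mul_iff hn]
  constructor
  · rintro ⟨hq, -, x, hx, rfl, -⟩
    simp only [tgt_zero, transport_zero_left]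
    exact ⟨⟨hq, hx⟩, trivial⟩
  · rintro ⟨h, rfl⟩
    exact ⟨h.1, zero_mem_TS h.1, γ.2, h.2, by simp [tgt_zero, transport_zero_left]⟩

theorem isRightUnit_iff (hn : 1 ≤ n) {γ : E n × E n} {q : E n} :
    IsRightUnit γ q ↔ γ ∈ TS n ∧ q = tgt γ := by
  rw [IsRightUnit, mul_iff hn]
  constructor
  · rintro ⟨-, h, x, -, h1, -⟩
    exact ⟨h, congrArg Prod.fst h1⟩
  · rintro ⟨h, rfl⟩
    exact ⟨tgt_mem_S hn h, h, 0, zero_mem _, by simp [transport_zero_right]⟩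

theorem eR_eq (hn : 1 ≤ n) {γ : E n × E n} (hγ : γ ∈ TS n) : eR γ = tgt γ :=
  ((isRightUnit_iff hn).1 (Classical.epsilon_spec ⟨_, (isRightUnit_iff hn).2 ⟨hγ, rfl⟩⟩)).2

theorem mem_leftFiber_iff (hn : 1 ≤ n) {γ γ' : E n × E n} (hγ : γ ∈ TS n) :
    γ' ∈ leftFiber γ ↔ γ'.1 = γ.1 ∧ γ'.2 ∈ T γ.1 := by
  simp only [leftFiber, isLeftUnit_iff hn, Set.mem_ofPred_eq]
  constructor
  · rintro ⟨h, q, ⟨-, rfl⟩, -, h2⟩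
    exact ⟨h2.symm, h2 ▸ h.2⟩
  · rintro ⟨h1, h2⟩
    have : γ' ∈ TS n := ⟨h1 ▸ hγ.1, h1 ▸ h2⟩
    exact ⟨this, γ.1, ⟨hγ, rfl⟩, this, h1.symm⟩

/-! ### Tangential projection and the inverse of the transport -/

theorem P_mem_T {p : E n} (hp : p ∈ S n) (w : E n) : P p w ∈ T p := by
  rw [mem_T_iff, P, inner_sub_right, inner_smul_right, real_inner_self_eq_norm_sq,
    mem_S_iff.1 hp, real_inner_comm]
  ring

theorem P_eq_self {p w : E n} (hw : w ∈ T p) : P p w = w := by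
  rw [P, real_inner_comm, mem_T_iff.1 hw, zero_smul, sub_zero]

theorem inner_P {p x : E n} (hx : x ∈ T p) (w : E n) : inner ℝ (P p w) x = inner ℝ w x := by
  rw [P, inner_sub_left, inner_smul_left, mem_T_iff.1 hx, mul_zero, sub_zero]

/-- `P_p` as a continuous linear map. -/
def PL (p : E n) : E n →L[ℝ] E n :=
  ContinuousLinearMap.id ℝ (E n) - (innerSL ℝ p).smulRight p

theorem PL_apply (p w : E n) : PL p w = P p w := by
  simp [PL, P, real_inner_comm]

theorem P_add (p w w' : E n) : P p (w + w') = P p w + P p w' := by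
  simp only [← PL_apply, map_add]

theorem P_smul (p : E n) (t : ℝ) (w : E n) : P p (t • w) = t • P p w := by
  simp only [← PL_apply, map_smul]

/-- `transport γ` as a continuous linear map. -/
def transportL (γ : E n × E n) : E n →L[ℝ] E n :=
  LinearMap.toContinuousLinearMap
    { toFun := transport γ
      map_add' := fun x y => by
        simp only [transport, shear, inner_add_right, PiLp.add_apply, PiLp.smul_apply, smul_eq_mul]
        module
      map_smul' := fun t x => by
        simp only [transport, shear, inner_smul_right, PiLp.add_apply, PiLp.smul_apply, smul_eq_mul,
          RingHom.id_apply]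
        module }

theorem transportL_apply (γ : E n × E n) (x : E n) : transportL γ x = transport γ x := rfl

/-- The inverse of `transport γ : T_p Sⁿ → T_q Sⁿ`, where `q` is the right projection of `γ`. -/
def transportInv (γ : E n × E n) (y : E n) : E n :=
  P γ.1 (y + inner ℝ y (γ.1 - p₀ n) • γ.2 +
    (inner ℝ (shift γ) y / scale γ) • (p₀ n + (γ.1 (Fin.last n) - 1) • γ.2))

section

variable {γ : E n × E n}

theorem transportInv_mem_T (hγ : γ ∈ TS n) (y : E n) : transportInv γ y ∈ T γ.1 := P_mem_T hγ.1 _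

/-- The formula for `transportInv` is designed as the adjoint of `transport γ` on $T_p$. Because the
transport is an isometry there, the adjoint is its inverse. -/
theorem inner_transportInv {x : E n} (hx : x ∈ T γ.1) (y : E n) :
    inner ℝ (transportInv γ y) x = inner ℝ y (transport γ x) := by
  rw [transportInv, inner_P hx]
  simp only [transport, shear, inner_add_left, inner_add_right, inner_smul_left, inner_smul_right,
    inner_p₀, PiLp.add_apply, PiLp.smul_apply, PiLp.sub_apply, p₀_last, real_inner_comm y,
    conj_trivial, smul_eq_mul]
  ring

theorem transportInv_transport (hn : 1 ≤ n) (hγ : γ ∈ TS n) {x : E n} (hx : x ∈ T γ.1) :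
    transportInv γ (transport γ x) = x := by
  have h := Submodule.sub_mem _ (transportInv_mem_T hγ (transport γ x)) hx
  rw [← sub_eq_zero, ← inner_self_eq_zero (𝕜 := ℝ), inner_sub_left, inner_transportInv h,
    inner_transport hn hγ hx h, sub_self]

theorem transport_transportInv (hn : 1 ≤ n) (hγ : γ ∈ TS n) {y : E n} (hy : y ∈ T (tgt γ)) :
    transport γ (transportInv γ y) = y := by
  obtain ⟨x, hx, rfl⟩ := exists_transport_eq hn hγ hy
  rw [transportInv_transport hn hγ hx]

/-! ### Left-invariant vector fields -/

theorem Represents.eq (hn : 1 ≤ n) (hγ : γ ∈ TS n) {c : ℝ → E n × E n} {ζ : E n × E n}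
    (h : Represents c γ ζ) : ζ.1 = 0 ∧ ζ.2 ∈ T γ.1 := by
  obtain ⟨-, h2, h3⟩ := h
  have h2' t := (mem_leftFiber_iff hn hγ).1 (h2 t)
  constructor
  · have h4 : HasDerivAt (fun t => (c t).1) ζ.1 0 := h3.fst
    simp only [fun t => (h2' t).1] at h4
    exact h4.unique (hasDerivAt_const _ _)
  · have h4 : HasDerivAt (fun t => (c t).2) ζ.2 0 := h3.snd
    have h5 := (innerSL ℝ γ.1).hasFDerivAt.comp_hasDerivAt 0 h4
    have h6 : (innerSL ℝ γ.1 : E n → ℝ) ∘ (fun t => (c t).2) = fun _ => 0 := by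
      ext t; exact mem_T_iff.1 (h2' t).2
    rw [h6] at h5
    exact mem_T_iff.2 (h5.unique (hasDerivAt_const _ _))

theorem represents_line (hn : 1 ≤ n) (hγ : γ ∈ TS n) {x : E n} (hx : x ∈ T γ.1) :
    Represents (fun t => (γ.1, γ.2 + t • x)) γ (vert x) := by
  refine ⟨by simp, fun t => (mem_leftFiber_iff hn hγ).2 ⟨rfl, add_mem hγ.2 (Submodule.smul_mem _ _ hx)⟩,
    ?_⟩
  apply (hasDerivAt_const _ _).prodMk
  simpa using ((hasDerivAt_id (0 : ℝ)).smul_const x).const_add γ.2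

end

/-- Invariance is applied to the product of $\gamma$ with its right unit. If $d(t)=\gamma c(t)$, the
fiber component of $c(t)$ is the transport of that of $d(t)$ minus $v$; differentiating shows that
the transport carries $\xi(\gamma)$ to $X$ at the right unit. This gives uniqueness of the
extension. -/
theorem IsLeftInvariantExtension.eq (hn : 1 ≤ n) {X : E n → E n} {ξ : E n × E n → E n × E n}
    (h : IsLeftInvariantExtension X ξ) {γ : E n × E n} (hγ : γ ∈ TS n) :
    ξ γ = vert (transportInv γ (X (tgt γ))) := by
  have hq := tgt_mem_S hn hγ
  have hm : Mul γ γ (tgt γ, 0) := ((isRightUnit_iff hn).2 ⟨hγ, rfl⟩).2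
  obtain ⟨c, d, hc, hcd, hd⟩ := h.1.invariant _ _ _ hm
  obtain ⟨e1, e2⟩ := hd.eq hn hγ
  have hcd' (t : ℝ) : (c t).2 = transport γ ((d t).2 - γ.2) := by
    obtain ⟨-, x, -, h1, h2⟩ := (mul_iff hn).1 (hcd t)
    rw [h1, h2, add_sub_cancel_left]
  have h4 : HasDerivAt (fun t => (c t).2) (ξ (tgt γ, 0)).2 0 := hc.2.2.snd
  have h5 := (transportL γ).hasFDerivAt.comp_hasDerivAt 0
    ((show HasDerivAt (fun t => (d t).2) (ξ γ).2 0 from hd.2.2.snd).sub_const γ.2)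
  have h6 : (transportL γ : E n → E n) ∘ (fun t => (d t).2 - γ.2) = fun t => (c t).2 := by
    ext1 t; exact (hcd' t).symm
  rw [h6] at h5
  have h7 := h4.unique h5
  rw [h.2 _ hq, transportL_apply] at h7
  refine Prod.ext e1 ?_
  rw [← transportInv_transport hn hγ e2, ← h7]
  rfl

section Smooth

theorem contDiff_shift : ContDiff ℝ ∞ (shift (n := n)) :=
  contDiff_snd.add ((((contDiff_norm_sq ℝ).comp contDiff_snd).div_const 2).smul
    (contDiff_fst.sub contDiff_const))

theorem contDiff_last : ContDiff ℝ ∞ (fun w : E n => w (Fin.last n)) := by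
  simp only [← inner_p₀]
  exact contDiff_const.inner ℝ contDiff_id

theorem contDiff_scale : ContDiff ℝ ∞ (scale (n := n)) :=
  contDiff_const.sub (contDiff_last.comp contDiff_shift)

theorem contDiffOn_tgt : ContDiffOn ℝ ∞ (tgt (n := n)) (TS n) :=
  contDiff_fst.contDiffOn.add
    ((((contDiff_last.comp contDiff_fst).sub contDiff_const).contDiffOn.div
      contDiff_scale.contDiffOn fun _ h => (scale_pos h).ne').smul contDiff_shift.contDiffOn)

theorem contDiff_P : ContDiff ℝ ∞ (fun x : E n × E n => P x.1 x.2) :=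
  contDiff_snd.sub ((contDiff_snd.inner ℝ contDiff_fst).smul contDiff_fst)

theorem contDiffOn_transportInv {f : E n × E n → E n} (hf : ContDiffOn ℝ ∞ f (TS n)) :
    ContDiffOn ℝ ∞ (fun γ => transportInv γ (f γ)) (TS n) := by
  have hfst : ContDiffOn ℝ ∞ (Prod.fst : E n × E n → E n) (TS n) := contDiff_fst.contDiffOn
  have hsnd : ContDiffOn ℝ ∞ (Prod.snd : E n × E n → E n) (TS n) := contDiff_snd.contDiffOn
  refine contDiff_P.comp_contDiffOn (hfst.prodMk ((hf.add
    ((hf.inner ℝ (hfst.sub contDiffOn_const)).smul hsnd)).add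
    (((contDiff_shift.contDiffOn.inner ℝ hf).div contDiff_scale.contDiffOn
      fun _ h => (scale_pos h).ne').smul (contDiffOn_const.add
      (((contDiff_last.comp contDiff_fst).contDiffOn.sub contDiffOn_const).smul hsnd)))))

end Smooth

theorem exists_isLeftInvariantExtension (hn : 1 ≤ n) {X : E n → E n} (hX : IsSection X) :
    IsLeftInvariantExtension X (fun γ => vert (transportInv γ (X (tgt γ)))) := by
  have hT {γ : E n × E n} (hγ : γ ∈ TS n) : X (tgt γ) ∈ T (tgt γ) :=
    hX.tangent _ (tgt_mem_S hn hγ)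
  refine ⟨⟨?_, fun γ hγ => ⟨_, represents_line hn hγ (transportInv_mem_T hγ _)⟩, ?_⟩, ?_⟩
  · exact contDiffOn_const.prodMk (contDiffOn_transportInv
      (hX.smooth.comp contDiffOn_tgt fun γ hγ => tgt_mem_S hn hγ))
  · intro γ₃ γ₁ γ₂ h
    obtain ⟨h₁, x, hx, rfl, rfl⟩ := (mul_iff hn).1 h
    have h₂ : (tgt γ₁, transport γ₁ x) ∈ TS n := ⟨tgt_mem_S hn h₁, transport_mem_T hn h₁ hx⟩
    have h₃ : (γ₁.1, γ₁.2 + x) ∈ TS n := ⟨h₁.1, add_mem h₁.2 hx⟩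
    obtain ⟨m₁, m₂⟩ := transport_mul hn h₁ hx
    set w := transportInv (γ₁.1, γ₁.2 + x) (X (tgt (γ₁.1, γ₁.2 + x)))
    have hw : w ∈ T γ₁.1 := transportInv_mem_T h₃ _
    have hxw (t : ℝ) : x + t • w ∈ T γ₁.1 := add_mem hx (Submodule.smul_mem _ _ hw)
    -- Functoriality is exactly the invariance of the field: both factors of the composite transport
    -- are inverted, and only that of $\gamma_2$ is undone.
    have e : transportInv (tgt γ₁, transport γ₁ x) (X (tgt (tgt γ₁, transport γ₁ x))) =
        transport γ₁ w := by
      rw [m₁, ← transport_transportInv hn h₃ (hT h₃), ← m₂ _ hw,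
        transportInv_transport hn h₂ (transport_mem_T hn h₁ hw)]
    refine ⟨_, _, ?_, fun t => (mul_iff hn).2 ⟨h₁, x + t • w, hxw t, rfl, rfl⟩, ?_⟩
    · rw [e]
      simpa only [← transportL_apply, map_add, map_smul] using
        represents_line hn h₂ (transport_mem_T hn h₁ hw)
    · simpa only [add_assoc] using represents_line hn h₃ hw
  · intro p hp
    have : transportInv (p, 0) (X p) = X p := by
      simpa [transport_zero_left] using
        transportInv_transport (γ := (p, 0)) hn (zero_mem_TS hp) (hX.tangent p hp)
    simp [tgt_zero, this]

theorem leftInvariantExtension_spec (hn : 1 ≤ n) {X : E n → E n} (hX : IsSection X) :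
    IsLeftInvariantExtension X (leftInvariantExtension X) :=
  Classical.epsilon_spec ⟨_, exists_isLeftInvariantExtension hn hX⟩

/-! ### Derivatives along the fibers at the units; the general bracket formula -/

section Derivatives

variable {p x : E n}

theorem hasDerivAt_fiber (p x : E n) :
    HasDerivAt (fun t : ℝ => ((p, t • x) : E n × E n)) (vert x) 0 := by
  apply (hasDerivAt_const _ _).prodMk
  simpa using (hasDerivAt_id (0 : ℝ)).smul_const x

theorem fiber_mem_TS (hp : p ∈ S n) (hx : x ∈ T p) (t : ℝ) : (p, t • x) ∈ TS n :=
  ⟨hp, Submodule.smul_mem _ _ hx⟩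

/-- The derivative within `TSⁿ` along a fiber is the derivative along a line. -/
theorem fderivWithin_vert_eq (hp : p ∈ S n) (hx : x ∈ T p) {F : Type*} [NormedAddCommGroup F]
    [NormedSpace ℝ F] {f : E n × E n → F} (hf : ContDiffOn ℝ ∞ f (TS n)) {f' : F}
    (h : HasDerivAt (fun t : ℝ => f (p, t • x)) f' 0) :
    fderivWithin ℝ f (TS n) (p, 0) (vert x) = f' := by
  have h1 := (hf.differentiableOn (by simp) (p, 0) (zero_mem_TS hp)).hasFDerivWithinAt
  -- Derivatives within $TS^n$ are not unique in the ambient space, but any of them has a determined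
  -- value on the velocity of a curve lying in $TS^n$.
  have h2 := HasFDerivWithinAt.comp_hasDerivAt_of_eq (f := fun t : ℝ => ((p, t • x) : E n × E n))
    (x := 0) h1 (hasDerivAt_fiber p x)
    (Filter.Eventually.of_forall fun t => fiber_mem_TS hp hx t) (by simp)
  exact h2.unique h

theorem hasDerivAt_shift (p x : E n) : HasDerivAt (fun t : ℝ => shift (p, t • x)) x 0 := by
  have h1 : (fun t : ℝ => shift (p, t • x)) =
      fun t => t • x + (t ^ 2 * (‖x‖ ^ 2 / 2)) • (p - p₀ n) := by
    ext1 t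
    simp only [shift, norm_smul, mul_pow, Real.norm_eq_abs, sq_abs]
    module
  rw [h1]
  exact (((hasDerivAt_id (0 : ℝ)).smul_const x).add ((((hasDerivAt_id (0 : ℝ)).pow 2).mul_const
    (‖x‖ ^ 2 / 2)).smul_const (p - p₀ n))).congr_deriv (by simp)

theorem hasDerivAt_scale (p x : E n) :
    HasDerivAt (fun t : ℝ => scale (p, t • x)) (-x (Fin.last n)) 0 := by
  have := ((innerSL ℝ (p₀ n)).hasFDerivAt.comp_hasDerivAt 0 (hasDerivAt_shift p x)).const_sub 1
  simp only [Function.comp_def, innerSL_apply_apply, inner_p₀] at this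
  exact this

/-- The shift vanishes at units, so only its derivative $x$ contributes, with coefficient
$p^{n+1}-1$. This factor is the anchor. -/
theorem hasDerivAt_tgt (p x : E n) :
    HasDerivAt (fun t : ℝ => tgt (p, t • x)) ((p (Fin.last n) - 1) • x) 0 := by
  have h := (((hasDerivAt_const (0 : ℝ) (p (Fin.last n) - 1)).div (hasDerivAt_scale p x)
    (by simp [scale_zero])).smul (hasDerivAt_shift p x)).const_add p
  exact h.congr_deriv (by simp [scale_zero, shift_zero])

theorem hasDerivAt_transportInv (p x : E n) {y : ℝ → E n} {y' : E n} (hy : HasDerivAt y y' 0) :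
    HasDerivAt (fun t : ℝ => transportInv (p, t • x) (y t))
      (P p (y' + inner ℝ (y 0) (p - p₀ n) • x + inner ℝ x (y 0) • p₀ n)) 0 := by
  have hx : HasDerivAt (fun t : ℝ => t • x) x 0 := by
    simpa using (hasDerivAt_id (0 : ℝ)).smul_const x
  have h1 := (hy.inner ℝ (hasDerivAt_const (0 : ℝ) (p - p₀ n))).smul hx
  have h2 := (((hasDerivAt_shift p x).inner ℝ hy).div (hasDerivAt_scale p x)
    (by simp [scale_zero])).smul ((hx.const_smul (p (Fin.last n) - 1)).const_add (p₀ n))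
  have h3 := (PL p).hasFDerivAt.comp_hasDerivAt 0 ((hy.add h1).add h2)
  simpa [Function.comp_def, PL_apply, transportInv, scale_zero, shift_zero] using h3

theorem fderivWithin_leftInvariantExtension (hn : 1 ≤ n) (hp : p ∈ S n) (hx : x ∈ T p)
    {Y : E n → E n} (hY : IsSection Y) {Y' : E n →L[ℝ] E n} (hY' : HasFDerivWithinAt Y Y' (S n) p) :
    fderivWithin ℝ (leftInvariantExtension Y) (TS n) (p, 0) (vert x) =
      vert ((p (Fin.last n) - 1) • P p (Y' x) - Y p (Fin.last n) • x +
        inner ℝ x (Y p) • P p (p₀ n)) := by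
  have hs := leftInvariantExtension_spec hn hY
  apply fderivWithin_vert_eq hp hx hs.1.smooth
  have h1 : (fun t : ℝ => leftInvariantExtension Y (p, t • x)) =
      fun t => vert (transportInv (p, t • x) (Y (tgt (p, t • x)))) := by
    ext1 t
    exact hs.eq hn (fiber_mem_TS hp hx t)
  rw [h1]
  apply (hasDerivAt_const _ _).prodMk
  have h2 := HasFDerivWithinAt.comp_hasDerivAt_of_eq (f := fun t : ℝ => tgt (p, t • x))
    (x := 0) hY' (hasDerivAt_tgt p x)
    (Filter.Eventually.of_forall fun t => tgt_mem_S hn (fiber_mem_TS hp hx t)) (by simp [tgt_zero])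
  have h3 := hasDerivAt_transportInv p x h2
  have h4 : inner ℝ (Y p) (p - p₀ n) = -Y p (Fin.last n) := by
    rw [inner_sub_right, real_inner_comm, mem_T_iff.1 (hY.tangent p hp), inner_p₀_right, zero_sub]
  refine h3.congr_deriv ?_
  simp only [zero_smul, tgt_zero, h4, P_add, P_smul, map_smul, P_eq_self hx, Function.comp_apply]
  module

/-- The bracket of the Lie algebroid in terms of derivatives on the sphere. -/
theorem bracket_eq (hn : 1 ≤ n) (hp : p ∈ S n) {X Y : E n → E n} (hX : IsSection X)
    (hY : IsSection Y) {X' Y' : E n →L[ℝ] E n} (hX' : HasFDerivWithinAt X X' (S n) p)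
    (hY' : HasFDerivWithinAt Y Y' (S n) p) :
    bracket X Y p = vert ((p (Fin.last n) - 1) • P p (Y' (X p) - X' (Y p)) -
      Y p (Fin.last n) • X p + X p (Fin.last n) • Y p) := by
  -- The terms $\langle X,Y\rangle P_p(p_0)$ of the two derivatives are symmetric in $X,Y$ and
  -- cancel.
  rw [bracket, VectorField.lieBracketWithin, (leftInvariantExtension_spec hn hX).2 p hp,
    (leftInvariantExtension_spec hn hY).2 p hp,
    fderivWithin_leftInvariantExtension hn hp (hX.tangent p hp) hY hY',
    fderivWithin_leftInvariantExtension hn hp (hY.tangent p hp) hX hX', vert, vert, vert,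
    Prod.mk_sub_mk, sub_zero, real_inner_comm (X p) (Y p), sub_eq_add_neg (Y' (X p)),
    ← neg_one_smul ℝ (X' (Y p)), P_add, P_smul]
  congr 1
  module

end Derivatives

/-! ### The sections $\tilde Y_i$, the anchor and the five claims -/

theorem inner_e (i : Fin (n + 1)) (w : E n) : inner ℝ (e i) w = w i := by
  simp [e, EuclideanSpace.inner_single_left]

theorem Ytilde_eq (i : Fin (n + 1)) (p : E n) : Ytilde i p = e i - p i • p := by
  rw [Ytilde, P, inner_e]

theorem isSection_Ytilde (i : Fin (n + 1)) : IsSection (Ytilde (n := n) i) :=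
  ⟨(contDiff_P.comp (contDiff_id.prodMk contDiff_const)).contDiffOn, fun _ hp => P_mem_T hp _⟩

theorem hasFDerivAt_Ytilde (i : Fin (n + 1)) (p : E n) :
    HasFDerivAt (Ytilde i) (-(p i • ContinuousLinearMap.id ℝ (E n) +
      (innerSL ℝ (e i)).smulRight p)) p := by
  have h := (((innerSL ℝ (e i)).hasFDerivAt (x := p)).smul (hasFDerivAt_id p)).const_sub (e i)
  have h2 : (Ytilde i : E n → E n) = fun p => e i - innerSL ℝ (e i) p • id p := by
    ext1 p; simp [Ytilde_eq, inner_e]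
  rw [h2]
  refine h.congr_fderiv ?_
  simp [inner_e]

theorem Ytilde_last (i : Fin (n + 1)) (p : E n) :
    Ytilde i p (Fin.last n) = δlast i - p i * p (Fin.last n) := by
  simp [Ytilde_eq, e, δlast, eq_comm]

theorem bracket_Ytilde (hn : 1 ≤ n) (i j : Fin (n + 1)) {p : E n} (hp : p ∈ S n) :
    bracket (Ytilde i) (Ytilde j) p =
      vert ((p j - δlast j) • Ytilde i p - (p i - δlast i) • Ytilde j p) := by
  rw [bracket_eq hn hp (isSection_Ytilde i) (isSection_Ytilde j)
    (hasFDerivAt_Ytilde i p).hasFDerivWithinAt (hasFDerivAt_Ytilde j p).hasFDerivWithinAt]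
  have hPp : P p p = 0 := by
    rw [P, real_inner_self_eq_norm_sq, mem_S_iff.1 hp]; simp
  -- The tangential part of the derivative of $\tilde Y_k$ along $x$ is $-p^kx$, since $P_p$ kills
  -- the multiple of $p$.
  have h (k : Fin (n + 1)) (x : E n) (hx : x ∈ T p) :
      P p (-(p k • x + inner ℝ (e k) x • p)) = -(p k) • x := by
    rw [← neg_one_smul ℝ, P_smul, P_add, P_smul, P_smul, hPp, P_eq_self hx]; module
  have hi := h j _ ((isSection_Ytilde i).tangent p hp)
  have hj := h i _ ((isSection_Ytilde j).tangent p hp)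
  simp only [← PL_apply] at hi hj ⊢
  simp only [Ytilde_last, map_sub]
  simp only [_root_.neg_apply, _root_.add_apply,
    _root_.smul_apply, ContinuousLinearMap.smulRight_apply, innerSL_apply_apply,
    ContinuousLinearMap.id_apply, hi, hj]
  congr 1
  module

/-- At $p_0$ the factor $p^{n+1}-1$ is zero, and so is the last coordinate of every tangent vector;
each term of `bracket_eq` vanishes. -/
theorem bracket_p₀ (hn : 1 ≤ n) {X Y : E n → E n} (hX : IsSection X) (hY : IsSection Y) :
    bracket X Y (p₀ n) = 0 := by
  have hp : p₀ n ∈ S n := mem_S_iff.2 norm_p₀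
  rw [bracket_eq hn hp hX hY (hX.smooth.differentiableOn (by simp) _ hp).hasFDerivWithinAt
    (hY.smooth.differentiableOn (by simp) _ hp).hasFDerivWithinAt,
    ← inner_p₀ (X _), ← inner_p₀ (Y _), mem_T_iff.1 (hX.tangent _ hp),
    mem_T_iff.1 (hY.tangent _ hp), p₀_last]
  simp [vert]

theorem contDiffOn_eR (hn : 1 ≤ n) : ContDiffOn ℝ ∞ (eR (n := n)) (TS n) :=
  contDiffOn_tgt.congr fun _ h => eR_eq hn h

theorem anchor_eq (hn : 1 ≤ n) {γ : E n × E n} (hγ : γ ∈ TS n) :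
    anchor γ = (γ.1, (γ.1 (Fin.last n) - 1) • γ.2) := by
  rw [anchor, eR_eq hn (zero_mem_TS hγ.1), tgt_zero, fderivWithin_vert_eq hγ.1 hγ.2
    (contDiffOn_eR hn) (f' := (γ.1 (Fin.last n) - 1) • γ.2)]
  simpa only [fun t => eR_eq hn (fiber_mem_TS hγ.1 hγ.2 t)] using hasDerivAt_tgt γ.1 γ.2

theorem sum_smul_e (w : E n) : ∑ i, w i • e i = w := by
  ext j; simp [e, Pi.single_apply]

theorem sum_smul_Ytilde (p w : E n) : ∑ i, w i • Ytilde i p = P p w := by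
  simp only [Ytilde, ← PL_apply, ← map_smul, ← map_sum, sum_smul_e]

theorem span_Ytilde {p : E n} (hp : p ∈ S n) :
    Submodule.span ℝ (Set.range fun i : Fin (n + 1) => Ytilde i p) = T p := by
  apply le_antisymm
  · rw [Submodule.span_le]
    rintro _ ⟨i, rfl⟩
    exact P_mem_T hp _
  · intro w hw
    rw [← P_eq_self hw, ← sum_smul_Ytilde]
    exact Submodule.sum_mem _ fun i _ => Submodule.smul_mem _ _ (Submodule.subset_span ⟨i, rfl⟩)

theorem span_Ytilde_ne {p : E n} (hp : p ∈ S n) {i : Fin (n + 1)} (hi : p i ≠ 0) :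
    Submodule.span ℝ (Set.range fun j : {j : Fin (n + 1) // j ≠ i} => Ytilde j.1 p) = T p := by
  apply le_antisymm
  · rw [Submodule.span_le]
    rintro _ ⟨j, rfl⟩
    exact P_mem_T hp _
  · intro w hw
    -- Subtracting this multiple of $p$ kills the $i$-th coordinate without changing the projection
    -- $P_p(w)$.
    have hw' : w - (w i / p i) • p + (w i / p i) • p = w := by abel
    have hPp : P p p = 0 := by
      rw [P, real_inner_self_eq_norm_sq, mem_S_iff.1 hp]; simp
    rw [← P_eq_self hw, ← hw', P_add, P_smul, hPp, smul_zero, add_zero, ← sum_smul_Ytilde]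
    refine Submodule.sum_mem _ fun j _ => ?_
    by_cases hj : j = i
    · subst hj
      simp [hi]
    · exact Submodule.smul_mem _ _ (Submodule.subset_span ⟨⟨j, hj⟩, rfl⟩)

/-- A relation is a vector $w$ with $w^i=0$ and $P_p(w)=0$. Then $w$ is a multiple of $p$, and
$p^i\ne0$ forces $w=0$. -/
theorem linearIndependent_Ytilde_ne {p : E n} {i : Fin (n + 1)} (hi : p i ≠ 0) :
    LinearIndependent ℝ (fun j : {j : Fin (n + 1) // j ≠ i} => Ytilde j.1 p) := by
  rw [Fintype.linearIndependent_iff]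
  intro g hg j
  set w : E n := WithLp.toLp 2 fun j => if h : j ≠ i then g ⟨j, h⟩ else 0 with hw
  have hwi : w i = 0 := by simp [hw]
  have hwj (j : {j : Fin (n + 1) // j ≠ i}) : w j = g j := by simp [hw, j.2]
  have h1 : P p w = 0 := by
    rw [← sum_smul_Ytilde, ← hg, ← Fintype.sum_subtype_add_sum_subtype (fun j => j ≠ i)]
    have : ∑ k : {k // ¬ k ≠ i}, w k • Ytilde (k : Fin (n + 1)) p = 0 :=
      Finset.sum_eq_zero fun k _ => by rw [not_not.1 k.2, hwi, zero_smul]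
    rw [this, add_zero]
    exact Finset.sum_congr rfl fun k _ => by rw [hwj]
  rw [P] at h1
  have h2 := congrArg (fun v : E n => v i) h1
  simp [hwi, hi] at h2
  rw [h2, zero_smul, sub_zero] at h1
  rw [← hwj, h1]
  rfl

end

end EuclideanLines

theorem proposition4p4 (n : ℕ) (hn : 2 ≤ n) :
    -- the bracket and the anchor are well defined
    ((∀ X : E n → E n, IsSection X →
        IsLeftInvariantExtension X (leftInvariantExtension X) ∧
        ∀ ξ, IsLeftInvariantExtension X ξ → Set.EqOn ξ (leftInvariantExtension X) (TS n)) ∧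
      (∀ γ ∈ TS n, ∃! q, IsRightUnit γ q) ∧
      ContDiffOn ℝ ∞ (eR (n := n)) (TS n) ∧
      (∀ i : Fin (n + 1), IsSection (Ytilde i))) ∧
    -- (1)
    (∀ p ∈ S n, Submodule.span ℝ (Set.range fun i : Fin (n + 1) => Ytilde i p) = T p) ∧
    -- (2)
    (∀ p ∈ S n, ∀ i : Fin (n + 1), p i ≠ 0 →
      LinearIndependent ℝ (fun j : {j : Fin (n + 1) // j ≠ i} => Ytilde j.1 p) ∧
      Submodule.span ℝ (Set.range fun j : {j : Fin (n + 1) // j ≠ i} => Ytilde j.1 p) = T p) ∧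
    -- (3)
    (∀ i j : Fin (n + 1), ∀ p ∈ S n,
      bracket (Ytilde i) (Ytilde j) p =
        vert ((p j - δlast j) • Ytilde i p - (p i - δlast i) • Ytilde j p)) ∧
    -- (4)
    (∀ γ ∈ TS n, anchor γ = (γ.1, (γ.1 (Fin.last n) - 1) • γ.2)) ∧
    -- (5)
    (∀ X Y : E n → E n, IsSection X → IsSection Y → bracket X Y (p₀ n) = 0) := by
  have h1 : 1 ≤ n := by omega
  refine ⟨⟨fun X hX => ⟨leftInvariantExtension_spec h1 hX, fun ξ hξ γ hγ => ?_⟩, fun γ hγ => ?_,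
    contDiffOn_eR h1, isSection_Ytilde⟩, fun p hp => span_Ytilde hp,
    fun p hp i hi => ⟨linearIndependent_Ytilde_ne hi, span_Ytilde_ne hp hi⟩,
    fun i j p hp => bracket_Ytilde h1 i j hp, fun γ hγ => anchor_eq h1 hγ,
    fun X Y hX hY => bracket_p₀ h1 hX hY⟩
  · rw [hξ.eq h1 hγ, (leftInvariantExtension_spec h1 hX).eq h1 hγ]
  · exact ⟨tgt γ, (isRightUnit_iff h1).2 ⟨hγ, rfl⟩, fun q hq => ((isRightUnit_iff h1).1 hq).2⟩
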